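/- Let $E_0>0$ and $V_\infty>0$. For $\xi\ge 0$ put $\phi(\xi)=\xi(\sqrt{1+\xi^2}-\xi)$, and for a continuous bounded function $V$ on $[0,1)$ put $\hat V(s)=V\big(s/\sqrt{1+s^2}\big)$ and, for $x\in(0,1)$ and $\xi=x/\sqrt{1-x^2}$, $$\mathcal F(V;x)=(1+\xi^2)\Big(\xi\sqrt{1+\xi^2}\int_\xi^\infty\frac{1}{\zeta^2(1+\zeta^2)^{3/2}}\Big(\int_0^\zeta s\,\hat V^2(s)\,ds\Big)d\zeta+E_0\,\phi(\xi)\Big).$$ Let $I\subset(0,\infty)$ and, for every $\nu\in I$, let $\Theta_\nu,V_\nu$ be continuous on $[0,1)$, $\Theta_\nu$ differentiable and $V_\nu$ twice differentiable on $(0,1)$, and suppose they solve the stationary self-similar axisymmetric Navier–Stokes system $$\nu\,\Theta_\nu'=\tfrac12\Theta_\nu^2-\mathcal F(V_\nu;x),\qquad \nu\,V_\nu''=\Theta_\nu V_\nu'\quad\text{on }(0,1),\qquad \Theta_\nu(0)=V_\nu(0)=0,\quad \lim_{x\to1^-}V_\nu(x)=V_\infty .$$ Then: 1. The family has bounded variation,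 uniformly in $\nu$: the total variations of $x\mapsto(1-x^2)\Theta_\nu(x)$ on $[0,1]$ (with value $0$ at $x=1$) and of $V_\nu$ on $[0,1)$ are bounded by a constant independent of $\nu\in I$; and for every $a\in(0,1)$ the total variation of $\Theta_\nu$ on $[0,a]$ is bounded by a constant independent of $\nu\in I$. 2. Every sequence in $I$ tending to $0$ has a subsequence along which $\Theta_\nu\to\Theta$ and $V_\nu\to V$ almost everywhere in $(0,1)$, where $\Theta<0$ on $(0,1)$ and $(\Theta,V)$ is a smooth stationary self-similar Euler solution, in the following sense. There is a function $P$ on $(0,\infty)$ such that, with $x=\xi/\sqrt{1+\xi^2}$, $\theta(\xi)=\Theta(x)/\sqrt{1+\xi^2}$ and $\hat V(\xi)=V(x)$, the functions $\theta,\hat V,P$ are $C^\infty$ on $(0,\infty)$ and satisfy there $$\Big[\tfrac{\theta^2}{2}+(1+\xi^2)P\Big]'=-\xi\hat V^2,\qquad \hat V'\theta=0,\qquad \Big[\theta^2-\xi\Big(\tfrac{\theta^2}{2}\Big)'+P\Big]'=0,$$ with $\theta(0)=0$ and $\theta'(\xi)\to0$ as $\xi\to\infty$. Explicitly, with $k_0=E_0+\tfrac12V_\infty^2$,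 $U=-\theta'$ and $W=\theta-\xi\theta'$, it is the solution with the negative sign: for $\xi>0$, $$\theta=-\sqrt{2k_0\phi(\xi)},\quad \hat V=V_\infty,\quad U=\sqrt{\tfrac{k_0}{2\phi(\xi)}}\;\frac{1-2\phi(\xi)}{\sqrt{1+\xi^2}},\quad W=-\sqrt{\tfrac{k_0}{2\phi(\xi)}}\;\frac{\xi}{\sqrt{1+\xi^2}},\quad P=E_0-k_0\frac{\xi}{\sqrt{1+\xi^2}} .$$ -/

import Mathlib

open Set Filter Topology MeasureTheory
open scoped ContDiff NNReal ENNReal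

noncomputable section

namespace SwirlingFlow

/-- The change of variables `ξ ↦ x = ξ / √(1 + ξ²)` from `[0, ∞)` onto `[0, 1)`. -/
def toX (ξ : ℝ) : ℝ := ξ / √(1 + ξ ^ 2)

/-- The inverse change of variables `x ↦ ξ = x / √(1 - x²)` from `[0, 1)` onto `[0, ∞)`. -/
def toXi (x : ℝ) : ℝ := x / √(1 - x ^ 2)

/-- `φ(ξ) = ξ (√(1 + ξ²) - ξ)`. -/
def phi (ξ : ℝ) : ℝ := ξ * (√(1 + ξ ^ 2) - ξ)

/-- The functional `𝒢(V ; ξ)` of a swirl profile `V` on `[0, ∞)`. -/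
def G (V : ℝ → ℝ) (ξ : ℝ) : ℝ :=
  ξ * √(1 + ξ ^ 2) *
    ∫ ζ in Ioi ξ, 1 / (ζ ^ 2 * (1 + ζ ^ 2) ^ (3 / 2 : ℝ)) * ∫ s in (0 : ℝ)..ζ, s * V s ^ 2

/-- The functional `ℱ(V ; x)` of a swirl profile `V` on `[0, 1)`: it is
`(1 + ξ²) (𝒢(V̂ ; ξ) + E₀ φ(ξ))` at `ξ = x / √(1 - x²)`, where `V̂(s) = V(s / √(1 + s²))`. -/
def F (E₀ : ℝ) (V : ℝ → ℝ) (x : ℝ) : ℝ :=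
  (1 + toXi x ^ 2) * (G (fun s => V (toX s)) (toXi x) + E₀ * phi (toXi x))

/-- `(Θ, V)` is a (classical) solution on `[0, 1)` of the stationary self-similar axisymmetric
Navier–Stokes system with viscosity `ν`, pressure constant `E₀` and swirl `V∞` at the vortex
core, in the variable `x`. -/
structure IsNSSolution (ν E₀ Vinf : ℝ) (Θ V : ℝ → ℝ) : Prop where
  continuousOn_Theta : ContinuousOn Θ (Ico 0 1)
  continuousOn_V : ContinuousOn V (Ico 0 1)
  differentiableAt_Theta : ∀ x ∈ Ioo (0 : ℝ) 1, DifferentiableAt ℝ Θ x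
  differentiableAt_V : ∀ x ∈ Ioo (0 : ℝ) 1, DifferentiableAt ℝ V x
  differentiableAt_deriv_V : ∀ x ∈ Ioo (0 : ℝ) 1, DifferentiableAt ℝ (deriv V) x
  eq_Theta : ∀ x ∈ Ioo (0 : ℝ) 1, ν * deriv Θ x = Θ x ^ 2 / 2 - F E₀ V x
  eq_V : ∀ x ∈ Ioo (0 : ℝ) 1, ν * deriv (deriv V) x = Θ x * deriv V x
  Theta_zero : Θ 0 = 0
  V_zero : V 0 = 0
  V_one : Tendsto V (𝓝[<] 1) (𝓝 Vinf)

/-- The triple `(θ, V, P)` of functions of `ξ ∈ (0, ∞)` is a smooth solution of the stationary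
self-similar axisymmetric system with viscosity `ν` (Euler when `ν = 0`). -/
structure IsSmoothSelfSimilarSolution (ν : ℝ) (θ V P : ℝ → ℝ) : Prop where
  smooth_theta : ContDiffOn ℝ ∞ θ (Ioi 0)
  smooth_V : ContDiffOn ℝ ∞ V (Ioi 0)
  smooth_P : ContDiffOn ℝ ∞ P (Ioi 0)
  eq_one : ∀ ξ ∈ Ioi (0 : ℝ),
    deriv (fun η => θ η ^ 2 / 2 + (1 + η ^ 2) * P η) ξ =
      ν * deriv (fun η => η * θ η - (1 + η ^ 2) * deriv θ η) ξ - ξ * V ξ ^ 2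
  eq_two : ∀ ξ ∈ Ioi (0 : ℝ),
    deriv V ξ * θ ξ = ν * (3 * ξ * deriv V ξ + (1 + ξ ^ 2) * deriv (deriv V) ξ)
  eq_three : ∀ ξ ∈ Ioi (0 : ℝ),
    deriv (fun η => θ η ^ 2 - η * deriv (fun τ => θ τ ^ 2 / 2) η + P η) ξ =
      ν * deriv (fun η =>
        η * θ η - η ^ 2 * deriv θ η - η * (1 + η ^ 2) * deriv (deriv θ) η) ξ

/-- The triple `(θ, V, P)` is the explicit self-similar Euler profile with parameters `V₀`, `E₀`
and the negative sign of the stream function; `k₀ = E₀ + V₀² / 2`, and the radial and axial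
velocities are `U = -θ'` and `W = θ - ξ θ'`. -/
structure IsNegativeEulerProfile (E₀ V₀ : ℝ) (θ V P : ℝ → ℝ) : Prop where
  theta_eq : ∀ ξ ∈ Ici (0 : ℝ), θ ξ = -√(2 * (E₀ + V₀ ^ 2 / 2) * phi ξ)
  V_eq : ∀ ξ ∈ Ioi (0 : ℝ), V ξ = V₀
  U_eq : ∀ ξ ∈ Ioi (0 : ℝ), -deriv θ ξ =
    √((E₀ + V₀ ^ 2 / 2) / (2 * phi ξ)) * ((1 - 2 * phi ξ) / √(1 + ξ ^ 2))
  W_eq : ∀ ξ ∈ Ioi (0 : ℝ), θ ξ - ξ * deriv θ ξ =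
    -(√((E₀ + V₀ ^ 2 / 2) / (2 * phi ξ)) * (ξ / √(1 + ξ ^ 2)))
  P_eq : ∀ ξ ∈ Ioi (0 : ℝ), P ξ = E₀ - (E₀ + V₀ ^ 2 / 2) * (ξ / √(1 + ξ ^ 2))
  theta_zero : θ 0 = 0
  U_infty : Tendsto (fun ξ => -deriv θ ξ) atTop (𝓝 0)

end SwirlingFlow

end

/-! Everything rests on monotonicity. With `k₀ = E₀ + V∞²/2`, the functional factors as `ℱ = weight
· (E₀ + tailMean)`, where `tailMean` averages means of the squared swirl (`F_eq`). An integrating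
factor fixes the sign of `V'`, so `V` increases from `0` to `V∞`; hence the averages increase and
lie in `[0, V∞²/2]`, and `ℱ` is increasing with `E₀ weight ≤ ℱ ≤ k₀ weight`. Comparison in the
Riccati equation then gives `Θ ≤ 0` and `Θ²/2 ≤ ℱ`, so `Θ` is decreasing and `-Θ ≤ √(2k₀/(1 - x))`.
These `ν`-free bounds control the variations.

For `ν → 0` the key is `sub_le_sq_Theta`: for `y < x`, either `Θ(x)²/2 ≥ ℱ(y) - η` or `Θ(x) ≤ -η(x -
y)/ν`. Since `ℱ ≥ E₀ weight`, `Θ` stays away from `0` at each point; the swirl equation then forces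
`V → V∞` (`le_V`), so `ℱ → k₀ weight`. The same dichotomy with `y` close to `x` yields `Θ²/2 → k₀
weight`, and `Θ ≤ 0` selects the negative root. The limit is unique and pointwise, so no compactness
theorem is needed. -/

namespace SwirlingFlow

/-! ### The change of variables and the weight. -/

lemma sqrt_one_add_sq_pos (ξ : ℝ) : 0 < √(1 + ξ ^ 2) := Real.sqrt_pos.2 (by positivity)

lemma sq_sqrt_one_add_sq (ξ : ℝ) : √(1 + ξ ^ 2) ^ 2 = 1 + ξ ^ 2 :=
  Real.sq_sqrt (by positivity)

lemma toX_nonneg {ξ : ℝ} (h : 0 ≤ ξ) : 0 ≤ toX ξ := by unfold toX; positivity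

lemma toX_pos {ξ : ℝ} (h : 0 < ξ) : 0 < toX ξ := by unfold toX; positivity

lemma toX_lt_one (ξ : ℝ) : toX ξ < 1 := by
  unfold toX
  rw [div_lt_one (sqrt_one_add_sq_pos ξ)]
  exact Real.lt_sqrt_of_sq_lt (by linarith)

lemma rpow_three_halves (ζ : ℝ) : (1 + ζ ^ 2) ^ (3 / 2 : ℝ) = √(1 + ζ ^ 2) ^ 3 := by
  rw [Real.sqrt_eq_rpow, ← Real.rpow_mul_natCast (by positivity)]
  norm_num

lemma hasDerivAt_sqrt_one_add_sq (ξ : ℝ) :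
    HasDerivAt (fun η : ℝ => √(1 + η ^ 2)) (ξ / √(1 + ξ ^ 2)) ξ := by
  have h := ((hasDerivAt_pow 2 ξ).const_add 1).sqrt (by positivity)
  convert h using 1
  norm_num
  field_simp

lemma hasDerivAt_toX (ξ : ℝ) : HasDerivAt toX (1 / √(1 + ξ ^ 2) ^ 3) ξ := by
  have h : HasDerivAt toX _ ξ :=
    (hasDerivAt_id ξ).div (hasDerivAt_sqrt_one_add_sq ξ) (sqrt_one_add_sq_pos ξ).ne'
  refine h.congr_deriv ?_
  have := sqrt_one_add_sq_pos ξ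
  have h2 := sq_sqrt_one_add_sq ξ
  simp only [id]
  field_simp
  linear_combination h2

lemma strictMono_toX : StrictMono toX :=
  strictMono_of_deriv_pos fun x => by
    rw [(hasDerivAt_toX x).deriv]
    have := sqrt_one_add_sq_pos x
    positivity

lemma tendsto_toX_atTop : Tendsto toX atTop (𝓝 1) := by
  have hl : Tendsto (fun ξ : ℝ => 1 - ξ⁻¹) atTop (𝓝 1) := by
    simpa using tendsto_inv_atTop_zero.const_sub (1 : ℝ)
  refine tendsto_of_tendsto_of_tendsto_of_le_of_le' hl tendsto_const_nhds ?_
    (Eventually.of_forall fun ξ => (toX_lt_one ξ).le)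
  filter_upwards [eventually_gt_atTop 0] with ξ hξ
  have hs := sqrt_one_add_sq_pos ξ
  have h1 : √(1 + ξ ^ 2) ≤ 1 + ξ := Real.sqrt_le_iff.2 ⟨by positivity, by nlinarith⟩
  unfold toX
  rw [le_div_iff₀ hs, sub_mul, inv_mul_eq_div]
  have h2 : ξ ≤ √(1 + ξ ^ 2) := Real.le_sqrt_of_sq_le (by linarith)
  have h3 : 1 ≤ √(1 + ξ ^ 2) / ξ := by rw [le_div_iff₀ hξ]; linarith
  linarith

lemma toXi_pos {x : ℝ} (hx : x ∈ Ioo (0 : ℝ) 1) : 0 < toXi x := by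
  have : 0 < 1 - x ^ 2 := by nlinarith [hx.1, hx.2]
  exact div_pos hx.1 (Real.sqrt_pos.2 this)

lemma one_add_toXi_sq {x : ℝ} (hx : x ∈ Ioo (0 : ℝ) 1) :
    1 + toXi x ^ 2 = 1 / (1 - x ^ 2) := by
  have : 0 < 1 - x ^ 2 := by nlinarith [hx.1, hx.2]
  unfold toXi
  rw [div_pow, Real.sq_sqrt this.le]
  field_simp
  ring

lemma toX_toXi {x : ℝ} (hx : x ∈ Ioo (0 : ℝ) 1) : toX (toXi x) = x := by
  have : 0 < 1 - x ^ 2 := by nlinarith [hx.1, hx.2]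
  have h := Real.sqrt_pos.2 this
  unfold toX
  rw [one_add_toXi_sq hx, Real.sqrt_div zero_le_one, Real.sqrt_one]
  unfold toXi
  field_simp

lemma toX_mem {ξ : ℝ} (h : 0 < ξ) : toX ξ ∈ Ioo (0 : ℝ) 1 := ⟨toX_pos h, toX_lt_one ξ⟩

lemma toXi_monotoneOn : MonotoneOn toXi (Ioo 0 1) := fun x hx y hy hxy => by
  rw [← toX_toXi hx, ← toX_toXi hy] at hxy
  exact strictMono_toX.le_iff_le.1 hxy

lemma phi_eq (ξ : ℝ) : phi ξ = ξ * √(1 + ξ ^ 2) * (1 - toX ξ) := by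
  have := sqrt_one_add_sq_pos ξ
  unfold phi toX
  field_simp

lemma phi_pos {ξ : ℝ} (h : 0 < ξ) : 0 < phi ξ := by
  rw [phi_eq]
  have := sqrt_one_add_sq_pos ξ
  have := toX_lt_one ξ
  have : 0 < 1 - toX ξ := by linarith
  positivity

/-- The weight `x / ((1 - x) (1 + x)²)`, that is, `(1 + ξ²) φ(ξ)` in the variable `x`. -/
noncomputable def weight (x : ℝ) : ℝ := x / ((1 - x) * (1 + x) ^ 2)

lemma one_add_sq_mul_phi {x : ℝ} (hx : x ∈ Ioo (0 : ℝ) 1) :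
    (1 + toXi x ^ 2) * phi (toXi x) = weight x := by
  have h0 : 0 < 1 - x ^ 2 := by nlinarith [hx.1, hx.2]
  have h1 : 0 < 1 - x := by linarith [hx.2]
  have h2 : 0 < 1 + x := by linarith [hx.1]
  have hs := Real.sqrt_pos.2 h0
  have hq := Real.sq_sqrt h0.le
  rw [phi_eq, toX_toXi hx, one_add_toXi_sq hx, Real.sqrt_div zero_le_one, Real.sqrt_one]
  unfold toXi weight
  have h3 : (x / √(1 - x ^ 2)) * (1 / √(1 - x ^ 2)) = x / (1 - x ^ 2) := by
    rw [div_mul_div_comm, ← pow_two, hq, mul_one]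
  rw [h3]
  have h4 : 1 - x ^ 2 = (1 - x) * (1 + x) := by ring
  rw [h4]
  field_simp

lemma weight_pos {x : ℝ} (hx : x ∈ Ioo (0 : ℝ) 1) : 0 < weight x := by
  have h1 : 0 < 1 - x := by linarith [hx.2]
  have h2 := hx.1
  unfold weight
  positivity

lemma weight_monotoneOn : MonotoneOn weight (Ioo 0 1) := by
  rintro x ⟨hx0, hx1⟩ y ⟨hy0, hy1⟩ hxy
  have h1 : 0 < 1 - x := by linarith
  have h2 : 0 < 1 - y := by linarith
  unfold weight
  rw [div_le_div_iff₀ (by positivity) (by positivity)]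
  -- The difference of the two sides is `(y - x)(1 + xy(1 + x + y))`.
  nlinarith [mul_nonneg (sub_nonneg.2 hxy) (by positivity : 0 ≤ x * y * (1 + x + y)),
    mul_nonneg (sub_nonneg.2 hxy) (mul_pos h1 h2).le, mul_pos hx0 hy0,
    mul_nonneg (sub_nonneg.2 hxy) (mul_pos hx0 hy0).le]

lemma continuousOn_weight : ContinuousOn weight (Ioo 0 1) := by
  unfold weight
  refine continuousOn_id.div (by fun_prop) fun x hx => ?_
  have h1 : 0 < 1 - x := by linarith [hx.2]
  have h2 : 0 < 1 + x := by linarith [hx.1]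
  positivity

lemma weight_le {x : ℝ} (hx : x ∈ Ioo (0 : ℝ) 1) : weight x ≤ 1 / (1 - x) := by
  have h1 : 0 < 1 - x := by linarith [hx.2]
  have h2 := hx.1
  unfold weight
  rw [div_le_div_iff₀ (by positivity) h1]
  nlinarith [mul_pos h1 (by nlinarith [hx.2] : 0 < 1 + x + x ^ 2)]

/-! ### The mean values of a swirl profile -/

lemma integrableOn_density (ξ : ℝ) :
    IntegrableOn (fun ζ : ℝ => 1 / √(1 + ζ ^ 2) ^ 3) (Ioi ξ) :=
  integrableOn_Ioi_deriv_of_nonneg' (fun x _ => hasDerivAt_toX x)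
    (fun x _ => by have := sqrt_one_add_sq_pos x; positivity) tendsto_toX_atTop

lemma integral_density (ξ : ℝ) : ∫ ζ in Ioi ξ, 1 / √(1 + ζ ^ 2) ^ 3 = 1 - toX ξ :=
  integral_Ioi_of_hasDerivAt_of_tendsto' (fun x _ => hasDerivAt_toX x)
    (integrableOn_density ξ) tendsto_toX_atTop

/-- `ζ⁻² ∫₀^ζ s u(s)² ds`. -/
noncomputable def radialMean (u : ℝ → ℝ) (ζ : ℝ) : ℝ :=
  (∫ s in (0 : ℝ)..ζ, s * u s ^ 2) / ζ ^ 2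

/-- The mean of `radialMean u` over `(ξ, ∞)` with respect to `(1 + ζ²) ^ (-3/2) dζ`. -/
noncomputable def tailMean (u : ℝ → ℝ) (ξ : ℝ) : ℝ :=
  (∫ ζ in Ioi ξ, 1 / √(1 + ζ ^ 2) ^ 3 * radialMean u ζ) / (1 - toX ξ)

/-- The density has mass `1 - toX ξ` on `(ξ, ∞)`, and `phi` carries the same factor, so normalising
the integral turns the prefactor of `G` into `phi`. -/
lemma G_eq (u : ℝ → ℝ) (ξ : ℝ) : G u ξ = phi ξ * tailMean u ξ := by
  have h : 0 < 1 - toX ξ := by linarith [toX_lt_one ξ]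
  unfold G tailMean
  rw [phi_eq]
  have : ∀ ζ : ℝ, 1 / (ζ ^ 2 * (1 + ζ ^ 2) ^ (3 / 2 : ℝ)) * ∫ s in (0 : ℝ)..ζ, s * u s ^ 2 =
      1 / √(1 + ζ ^ 2) ^ 3 * radialMean u ζ := fun ζ => by
    unfold radialMean
    rw [rpow_three_halves, one_div_mul_eq_div, div_mul_div_comm, one_mul, mul_comm (ζ ^ 2)]
  simp_rw [this]
  field_simp

lemma F_eq (E₀ : ℝ) (V : ℝ → ℝ) {x : ℝ} (hx : x ∈ Ioo (0 : ℝ) 1) :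
    F E₀ V x = weight x * (E₀ + tailMean (fun s => V (toX s)) (toXi x)) := by
  unfold F
  rw [G_eq, ← one_add_sq_mul_phi hx]
  ring

section Mean

variable {u : ℝ → ℝ} {c : ℝ}

lemma intervalIntegrable_mul_sq (hu : MonotoneOn u (Ici 0)) {a b : ℝ} (ha : 0 ≤ a)
    (hb : 0 ≤ b) : IntervalIntegrable (fun s => s * u s ^ 2) volume a b := by
  have hs : uIcc a b ⊆ Ici 0 := fun s hs => (le_min ha hb).trans hs.1
  have h : IntervalIntegrable u volume a b := (hu.mono hs).intervalIntegrable
  have hb : ∃ C, ∀ s ∈ uIcc a b, ‖u s‖ ≤ C := by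
    refine ⟨max |u (max a b)| |u (min a b)|, fun s h => ?_⟩
    have h1 : u s ≤ u (max a b) := hu (hs h) (hs ⟨min_le_max, le_rfl⟩) h.2
    have h2 : u (min a b) ≤ u s := hu (hs ⟨le_rfl, min_le_max⟩) (hs h) h.1
    rw [Real.norm_eq_abs]
    rcases abs_cases (u s) with h | h
    · exact (h.1 ▸ h1.trans (le_abs_self _)).trans (le_max_left _ _)
    · exact (h.1 ▸ (neg_le_neg h2).trans (neg_le_abs _)).trans (le_max_right _ _)
  obtain ⟨C, hC⟩ := hb
  have h2 : IntervalIntegrable (fun s => u s * u s) volume a b := by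
    rw [intervalIntegrable_iff] at h ⊢
    refine Integrable.bdd_mul (c := C) h h.aestronglyMeasurable ?_
    filter_upwards [ae_restrict_mem measurableSet_uIoc] with s hs
    exact hC s (uIoc_subset_uIcc hs)
  have h3 := h2.continuousOn_mul (f := fun s => u s * u s) (g := fun s : ℝ => s) continuousOn_id
  simpa only [pow_two] using h3

lemma integral_mul_const (a b k : ℝ) : ∫ s in a..b, s * k = k * (b ^ 2 - a ^ 2) / 2 := by
  rw [intervalIntegral.integral_mul_const, integral_id]
  ring

lemma le_integral_mul_sq (hu : MonotoneOn u (Ici 0)) (h0 : ∀ s, 0 ≤ s → 0 ≤ u s) {a b : ℝ}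
    (ha : 0 ≤ a) (hab : a ≤ b) :
    u a ^ 2 * (b ^ 2 - a ^ 2) / 2 ≤ ∫ s in a..b, s * u s ^ 2 := by
  rw [← integral_mul_const]
  refine intervalIntegral.integral_mono_on hab ((by fun_prop : Continuous _).intervalIntegrable _ _)
    (intervalIntegrable_mul_sq hu ha (ha.trans hab)) fun s hs => ?_
  have h1 := h0 a ha
  have h2 : u a ≤ u s := hu ha (ha.trans hs.1) hs.1
  have h3 : 0 ≤ s := ha.trans hs.1
  gcongr

lemma integral_mul_sq_le (hu : MonotoneOn u (Ici 0)) (h0 : ∀ s, 0 ≤ s → 0 ≤ u s) {a b : ℝ}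
    (ha : 0 ≤ a) (hab : a ≤ b) (hc : u b ≤ c) :
    ∫ s in a..b, s * u s ^ 2 ≤ c ^ 2 * (b ^ 2 - a ^ 2) / 2 := by
  rw [← integral_mul_const]
  refine intervalIntegral.integral_mono_on hab (intervalIntegrable_mul_sq hu ha (ha.trans hab))
    ((by fun_prop : Continuous _).intervalIntegrable _ _) fun s hs => ?_
  have h3 : 0 ≤ s := ha.trans hs.1
  have h1 := h0 s h3
  have h2 : u s ≤ u b := hu h3 (ha.trans hab) hs.2
  have := h2.trans hc
  gcongr

lemma radialMean_nonneg {ζ : ℝ} (hζ : 0 ≤ ζ) : 0 ≤ radialMean u ζ :=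
  div_nonneg (intervalIntegral.integral_nonneg hζ fun _ hs => mul_nonneg hs.1 (sq_nonneg _))
    (sq_nonneg _)

lemma radialMean_le (hu : MonotoneOn u (Ici 0)) (h0 : ∀ s, 0 ≤ s → 0 ≤ u s) {ζ : ℝ}
    (hζ : 0 < ζ) (hc : u ζ ≤ c) : radialMean u ζ ≤ c ^ 2 / 2 := by
  have := integral_mul_sq_le hu h0 le_rfl hζ.le hc
  unfold radialMean
  rw [div_le_iff₀ (by positivity)]
  linarith

/-- Up to a factor `1/2` this is the mean of `u²` with respect to `d(s²)`: passing from `[0, a]` to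
`[0, b]` adjoins values at least `u(a)²` to a mean at most `u(a)²`. -/
lemma radialMean_monotoneOn (hu : MonotoneOn u (Ici 0)) (h0 : ∀ s, 0 ≤ s → 0 ≤ u s) :
    MonotoneOn (radialMean u) (Ioi 0) := by
  intro a ha b hb hab
  rw [mem_Ioi] at ha hb
  have h1 := integral_mul_sq_le hu h0 le_rfl ha.le (le_refl (u a))
  have h2 := le_integral_mul_sq hu h0 ha.le hab
  have h3 := intervalIntegral.integral_add_adjacent_intervals
    (intervalIntegrable_mul_sq hu le_rfl ha.le) (intervalIntegrable_mul_sq hu ha.le hb.le)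
  unfold radialMean
  rw [div_le_div_iff₀ (by positivity) (by positivity), ← h3]
  have h4 : 0 ≤ b ^ 2 - a ^ 2 := by nlinarith
  nlinarith [mul_le_mul_of_nonneg_right h1 h4, mul_le_mul_of_nonneg_left h2 (sq_nonneg a)]

/-- Drops the integral over `[0, ε]`, so a lower bound for `u` at the single point `ε` suffices in
the limit. -/
lemma le_radialMean (hu : MonotoneOn u (Ici 0)) (h0 : ∀ s, 0 ≤ s → 0 ≤ u s) {ε ζ : ℝ}
    (hε : 0 < ε) (hεζ : ε ≤ ζ) : u ε ^ 2 * (1 - ε ^ 2 / ζ ^ 2) / 2 ≤ radialMean u ζ := by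
  have hζ := hε.trans_le hεζ
  have h2 := le_integral_mul_sq hu h0 hε.le hεζ
  have h3 := intervalIntegral.integral_add_adjacent_intervals
    (intervalIntegrable_mul_sq hu le_rfl hε.le) (intervalIntegrable_mul_sq hu hε.le hζ.le)
  have h4 : 0 ≤ ∫ s in (0 : ℝ)..ε, s * u s ^ 2 :=
    intervalIntegral.integral_nonneg hε.le fun _ hs => mul_nonneg hs.1 (sq_nonneg _)
  unfold radialMean
  rw [le_div_iff₀ (by positivity)]
  calc u ε ^ 2 * (1 - ε ^ 2 / ζ ^ 2) / 2 * ζ ^ 2 = u ε ^ 2 * (ζ ^ 2 - ε ^ 2) / 2 := by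
        field_simp
    _ ≤ _ := by linarith

lemma integrableOn_density_mul_radialMean (hu : MonotoneOn u (Ici 0))
    (h0 : ∀ s, 0 ≤ s → 0 ≤ u s) (hc : ∀ s, 0 ≤ s → u s ≤ c) {ξ : ℝ} (hξ : 0 ≤ ξ) :
    IntegrableOn (fun ζ : ℝ => 1 / √(1 + ζ ^ 2) ^ 3 * radialMean u ζ) (Ioi ξ) := by
  have hm : AEStronglyMeasurable (radialMean u) (volume.restrict (Ioi ξ)) :=
    (aemeasurable_restrict_of_monotoneOn measurableSet_Ioi
      ((radialMean_monotoneOn hu h0).mono (Ioi_subset_Ioi hξ))).aestronglyMeasurable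
  refine Integrable.mul_bdd (c := c ^ 2 / 2) (integrableOn_density ξ) hm ?_
  filter_upwards [ae_restrict_mem measurableSet_Ioi] with s hs
  have hs' : 0 < s := hξ.trans_lt hs
  rw [Real.norm_eq_abs, abs_of_nonneg (radialMean_nonneg hs'.le)]
  exact radialMean_le hu h0 hs' (hc s hs'.le)

lemma tailMean_nonneg {ξ : ℝ} (hξ : 0 ≤ ξ) : 0 ≤ tailMean u ξ := by
  refine div_nonneg (setIntegral_nonneg measurableSet_Ioi fun ζ hζ => ?_)
    (by linarith [toX_lt_one ξ])
  exact mul_nonneg (by positivity) (radialMean_nonneg (hξ.trans (le_of_lt hζ)))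

lemma tailMean_le (hu : MonotoneOn u (Ici 0)) (h0 : ∀ s, 0 ≤ s → 0 ≤ u s)
    (hc : ∀ s, 0 ≤ s → u s ≤ c) {ξ : ℝ} (hξ : 0 ≤ ξ) : tailMean u ξ ≤ c ^ 2 / 2 := by
  have h : 0 < 1 - toX ξ := by linarith [toX_lt_one ξ]
  unfold tailMean
  rw [div_le_iff₀ h, ← integral_density, mul_comm, ← MeasureTheory.integral_mul_const]
  refine setIntegral_mono_on (integrableOn_density_mul_radialMean hu h0 hc hξ)
    ((integrableOn_density ξ).mul_const _) measurableSet_Ioi fun ζ hζ => ?_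
  have hζ' : 0 < ζ := hξ.trans_lt hζ
  have := radialMean_le hu h0 hζ' (hc ζ hζ'.le)
  gcongr

lemma radialMean_le_tailMean (hu : MonotoneOn u (Ici 0)) (h0 : ∀ s, 0 ≤ s → 0 ≤ u s)
    (hc : ∀ s, 0 ≤ s → u s ≤ c) {ξ : ℝ} (hξ : 0 < ξ) : radialMean u ξ ≤ tailMean u ξ := by
  have h : 0 < 1 - toX ξ := by linarith [toX_lt_one ξ]
  unfold tailMean
  rw [le_div_iff₀ h, ← integral_density, mul_comm, ← MeasureTheory.integral_mul_const]
  refine setIntegral_mono_on ((integrableOn_density ξ).mul_const _)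
    (integrableOn_density_mul_radialMean hu h0 hc hξ.le) measurableSet_Ioi fun ζ hζ => ?_
  have := radialMean_monotoneOn hu h0 hξ (hξ.trans hζ) (le_of_lt hζ)
  gcongr

/-- The mean over `(a, ∞)` combines the mean over `(a, b]`, at most `radialMean u b ≤ tailMean u b`,
with the mean over `(b, ∞)`, which is `tailMean u b`. -/
lemma tailMean_monotoneOn (hu : MonotoneOn u (Ici 0)) (h0 : ∀ s, 0 ≤ s → 0 ≤ u s)
    (hc : ∀ s, 0 ≤ s → u s ≤ c) : MonotoneOn (tailMean u) (Ioi 0) := by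
  intro a ha b hb hab
  rw [mem_Ioi] at ha hb
  have hA : 0 < 1 - toX a := by linarith [toX_lt_one a]
  have hB : 0 < 1 - toX b := by linarith [toX_lt_one b]
  have hle := radialMean_le_tailMean hu h0 hc hb
  have hi := integrableOn_density_mul_radialMean hu h0 hc ha.le
  have hsub : Ioc a b ⊆ Ioi a := fun x hx => hx.1
  have hsplit := setIntegral_union (μ := volume) (Ioc_disjoint_Ioi (le_refl b))
    measurableSet_Ioi (hi.mono_set hsub)
    (integrableOn_density_mul_radialMean hu h0 hc hb.le)
  have hsplit' := setIntegral_union (μ := volume) (Ioc_disjoint_Ioi (le_refl b))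
    measurableSet_Ioi ((integrableOn_density a).mono_set hsub) (integrableOn_density b)
  rw [Ioc_union_Ioi_eq_Ioi hab] at hsplit hsplit'
  rw [integral_density, integral_density] at hsplit'
  have h1 : ∫ ζ in Ioc a b, 1 / √(1 + ζ ^ 2) ^ 3 * radialMean u ζ ≤
      (toX b - toX a) * radialMean u b := by
    rw [show toX b - toX a = ∫ ζ in Ioc a b, 1 / √(1 + ζ ^ 2) ^ 3 by linarith,
      ← MeasureTheory.integral_mul_const]
    refine setIntegral_mono_on (hi.mono_set hsub)
      (((integrableOn_density a).mono_set hsub).mul_const _) measurableSet_Ioc fun ζ hζ => ?_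
    have := radialMean_monotoneOn hu h0 (ha.trans hζ.1) hb hζ.2
    gcongr
  have h2 : ∫ ζ in Ioi b, 1 / √(1 + ζ ^ 2) ^ 3 * radialMean u ζ =
      (1 - toX b) * tailMean u b := by
    unfold tailMean
    field_simp
  have h3 : tailMean u a = (∫ ζ in Ioi a, 1 / √(1 + ζ ^ 2) ^ 3 * radialMean u ζ) /
    (1 - toX a) := rfl
  rw [h3, div_le_iff₀ hA, hsplit, h2]
  have h4 : 0 ≤ toX b - toX a := sub_nonneg.2 (strictMono_toX.monotone hab)
  nlinarith [mul_le_mul_of_nonneg_left hle h4]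

end Mean

end SwirlingFlow

/-! ### Two real-variable tools: variation bounds and comparison. -/

lemma eVariationOn_le_of_abs_sub_le {s : Set ℝ} {f g : ℝ → ℝ} {A B : ℝ}
    (hfg : ∀ x ∈ s, ∀ y ∈ s, x ≤ y → |f y - f x| ≤ g y - g x)
    (hA : ∀ x ∈ s, A ≤ g x) (hB : ∀ x ∈ s, g x ≤ B) :
    eVariationOn f s ≤ ENNReal.ofReal (B - A) := by
  refine iSup_le ?_
  rintro ⟨n, ⟨u, hu, us⟩⟩
  have key : ∀ i, |f (u (i + 1)) - f (u i)| ≤ g (u (i + 1)) - g (u i) := fun i =>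
    hfg _ (us i) _ (us (i + 1)) (hu (Nat.le_succ _))
  calc ∑ i ∈ Finset.range n, edist (f (u (i + 1))) (f (u i))
      ≤ ∑ i ∈ Finset.range n, ENNReal.ofReal (g (u (i + 1)) - g (u i)) :=
        Finset.sum_le_sum fun i _ => by
          rw [edist_dist, Real.dist_eq]
          exact ENNReal.ofReal_le_ofReal (key i)
    _ = ENNReal.ofReal (∑ i ∈ Finset.range n, (g (u (i + 1)) - g (u i))) :=
        (ENNReal.ofReal_sum_of_nonneg fun i _ => (abs_nonneg _).trans (key i)).symm
    _ ≤ ENNReal.ofReal (B - A) := by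
        rw [Finset.sum_range_sub (fun i => g (u i))]
        exact ENNReal.ofReal_le_ofReal (sub_le_sub (hB _ (us n)) (hA _ (us 0)))

/-- A continuous function which starts nonpositive and does not increase where it is positive
stays nonpositive. -/
lemma nonpos_of_deriv_nonpos_of_pos {f : ℝ → ℝ} {a b : ℝ} (hab : a ≤ b)
    (hc : ContinuousOn f (Icc a b)) (ha : f a ≤ 0)
    (hf : ∀ t ∈ Ioo a b, 0 < f t → deriv f t ≤ 0)
    (hd : ∀ t ∈ Ioo a b, DifferentiableAt ℝ f t) : f b ≤ 0 := by
  have hS : IsCompact (Icc a b ∩ f ⁻¹' Iic 0) :=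
    isCompact_Icc.of_isClosed_subset
      (hc.preimage_isClosed_of_isClosed isClosed_Icc isClosed_Iic) inter_subset_left
  -- `s` is the last point with `f ≤ 0`; beyond it `f` is positive, hence nonincreasing.
  obtain ⟨s, ⟨hs, hfs⟩, hmax⟩ := hS.exists_isGreatest ⟨a, ⟨le_rfl, hab⟩, ha⟩
  have hanti : AntitoneOn f (Icc s b) := by
    refine antitoneOn_of_deriv_nonpos (convex_Icc s b) (hc.mono (Icc_subset_Icc_left hs.1))
      (fun t ht => ?_) fun t ht => ?_
    · rw [interior_Icc] at ht
      exact (hd t ⟨hs.1.trans_lt ht.1, ht.2⟩).differentiableWithinAt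
    · rw [interior_Icc] at ht
      refine hf t ⟨hs.1.trans_lt ht.1, ht.2⟩ (not_le.1 fun h => ?_)
      exact absurd (hmax ⟨⟨hs.1.trans ht.1.le, ht.2.le⟩, h⟩) (not_le.2 ht.1)
  exact (hanti ⟨le_rfl, hs.2⟩ ⟨hs.2, le_rfl⟩ hs.2).trans hfs

namespace SwirlingFlow

/-! ### Estimates at fixed viscosity. -/

namespace IsNSSolution

variable {ν E₀ Vinf : ℝ} {Θ V : ℝ → ℝ}

lemma Icc_subset_Ico {b : ℝ} (hb : b < 1) : Icc (0 : ℝ) b ⊆ Ico 0 1 :=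
  fun _ hx => ⟨hx.1, hx.2.trans_lt hb⟩

/-- `V'` is a nonnegative multiple of a positive function. -/
lemma deriv_V_nonneg (h : IsNSSolution ν E₀ Vinf Θ V) (hν : 0 < ν) (hV : 0 < Vinf) :
    ∀ x ∈ Ioo (0 : ℝ) 1, 0 ≤ deriv V x := by
  have hΘ : ContinuousOn Θ (Ioo 0 1) := h.continuousOn_Theta.mono Ioo_subset_Ico_self
  set c : ℝ := 1 / 2
  have hcm : c ∈ Ioo (0 : ℝ) 1 := by norm_num [c]
  have hΦ : ∀ x ∈ Ioo (0 : ℝ) 1, HasDerivAt (fun y => ∫ t in c..y, Θ t) (Θ x) x := by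
    intro x hx
    refine intervalIntegral.integral_hasDerivAt_right ?_
      (hΘ.stronglyMeasurableAtFilter isOpen_Ioo x hx) (hΘ.continuousAt (isOpen_Ioo.mem_nhds hx))
    exact (hΘ.mono ((convex_Ioo 0 1).ordConnected.uIcc_subset hcm hx)).intervalIntegrable
  have hd : ∀ x ∈ Ioo (0 : ℝ) 1,
      HasDerivAt (fun y => deriv V y * Real.exp (-(∫ t in c..y, Θ t) / ν)) 0 x := by
    intro x hx
    have h1 := (h.differentiableAt_deriv_V x hx).hasDerivAt.mul
      (((hΦ x hx).neg.div_const ν).exp)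
    refine h1.congr_deriv ?_
    have h2 : deriv (deriv V) x = Θ x * deriv V x / ν := by
      rw [← h.eq_V x hx]; field_simp
    rw [h2]
    ring
  have hconst : ∀ x ∈ Ioo (0 : ℝ) 1, deriv V x * Real.exp (-(∫ t in c..x, Θ t) / ν) =
      deriv V c := by
    intro x hx
    have := isOpen_Ioo.is_const_of_deriv_eq_zero (isPreconnected_Ioo)
      (fun y hy => (hd y hy).differentiableAt.differentiableWithinAt)
      (fun y hy => (hd y hy).deriv) hx hcm
    simpa using this
  -- `V'` has one sign throughout; a negative one would make `V` decrease from `0`, against `V∞ >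
  -- 0`.
  have hpos : 0 ≤ deriv V c := by
    by_contra! hneg
    have hanti : AntitoneOn V (Ico 0 1) := by
      refine antitoneOn_of_deriv_nonpos (convex_Ico 0 1) h.continuousOn_V ?_ ?_
      · rw [interior_Ico]
        exact fun x hx => (h.differentiableAt_V x hx).differentiableWithinAt
      · rw [interior_Ico]
        intro x hx
        have h1 := hconst x hx
        have h2 := Real.exp_pos (-(∫ t in c..x, Θ t) / ν)
        by_contra! h3
        have := mul_pos h3 h2
        linarith
    have hle : Vinf ≤ 0 := by
      refine le_of_tendsto h.V_one ?_
      filter_upwards [Ioo_mem_nhdsLT zero_lt_one] with x hx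
      have := hanti ⟨le_rfl, zero_lt_one⟩ ⟨hx.1.le, hx.2⟩ hx.1.le
      rwa [h.V_zero] at this
    linarith
  intro x hx
  have h1 := hconst x hx
  have h2 := Real.exp_pos (-(∫ t in c..x, Θ t) / ν)
  by_contra! h3
  have := mul_neg_of_neg_of_pos h3 h2
  linarith

lemma V_monotoneOn (h : IsNSSolution ν E₀ Vinf Θ V) (hν : 0 < ν) (hV : 0 < Vinf) :
    MonotoneOn V (Ico 0 1) := by
  refine monotoneOn_of_deriv_nonneg (convex_Ico 0 1) h.continuousOn_V ?_ ?_
  · rw [interior_Ico]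
    exact fun x hx => (h.differentiableAt_V x hx).differentiableWithinAt
  · rw [interior_Ico]
    exact h.deriv_V_nonneg hν hV

lemma V_nonneg (h : IsNSSolution ν E₀ Vinf Θ V) (hν : 0 < ν) (hV : 0 < Vinf) {x : ℝ}
    (hx : x ∈ Ico (0 : ℝ) 1) : 0 ≤ V x :=
  h.V_zero ▸ h.V_monotoneOn hν hV ⟨le_rfl, zero_lt_one⟩ hx hx.1

lemma V_le (h : IsNSSolution ν E₀ Vinf Θ V) (hν : 0 < ν) (hV : 0 < Vinf) {x : ℝ}
    (hx : x ∈ Ico (0 : ℝ) 1) : V x ≤ Vinf := by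
  refine ge_of_tendsto h.V_one ?_
  filter_upwards [Ioo_mem_nhdsLT hx.2] with y hy
  exact h.V_monotoneOn hν hV hx ⟨hx.1.trans hy.1.le, hy.2⟩ hy.1.le

lemma toX_mem_Ico {ξ : ℝ} (hξ : 0 ≤ ξ) : toX ξ ∈ Ico (0 : ℝ) 1 := ⟨toX_nonneg hξ, toX_lt_one ξ⟩

lemma comp_monotoneOn (h : IsNSSolution ν E₀ Vinf Θ V) (hν : 0 < ν) (hV : 0 < Vinf) :
    MonotoneOn (fun s => V (toX s)) (Ici 0) := fun _ ha _ hb hab =>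
  h.V_monotoneOn hν hV (toX_mem_Ico ha) (toX_mem_Ico hb) (strictMono_toX.monotone hab)

lemma F_monotoneOn (h : IsNSSolution ν E₀ Vinf Θ V) (hν : 0 < ν) (hE : 0 < E₀) (hV : 0 < Vinf) :
    MonotoneOn (F E₀ V) (Ioo 0 1) := by
  intro x hx y hy hxy
  rw [F_eq E₀ V hx, F_eq E₀ V hy]
  have h1 := tailMean_nonneg (u := fun s => V (toX s)) (toXi_pos hx).le
  have h2 := tailMean_monotoneOn (h.comp_monotoneOn hν hV)
    (fun s hs => h.V_nonneg hν hV (toX_mem_Ico hs)) (fun s hs => h.V_le hν hV (toX_mem_Ico hs))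
    (toXi_pos hx) (toXi_pos hy) (toXi_monotoneOn hx hy hxy)
  have h3 := weight_monotoneOn hx hy hxy
  have h4 := (weight_pos hy).le
  have : 0 ≤ E₀ + tailMean (fun s => V (toX s)) (toXi x) := by positivity
  gcongr

lemma F_pos (hE : 0 < E₀) {x : ℝ} (hx : x ∈ Ioo (0 : ℝ) 1) : 0 < F E₀ V x := by
  rw [F_eq E₀ V hx]
  have h1 := tailMean_nonneg (u := fun s => V (toX s)) (toXi_pos hx).le
  have := weight_pos hx
  positivity

lemma F_ge {x : ℝ} (hx : x ∈ Ioo (0 : ℝ) 1) : E₀ * weight x ≤ F E₀ V x := by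
  rw [F_eq E₀ V hx]
  nlinarith [mul_nonneg (weight_pos hx).le
    (tailMean_nonneg (u := fun s => V (toX s)) (toXi_pos hx).le)]

lemma F_le (h : IsNSSolution ν E₀ Vinf Θ V) (hν : 0 < ν) (hV : 0 < Vinf) {x : ℝ}
    (hx : x ∈ Ioo (0 : ℝ) 1) : F E₀ V x ≤ (E₀ + Vinf ^ 2 / 2) * weight x := by
  rw [F_eq E₀ V hx, mul_comm]
  have := tailMean_le (h.comp_monotoneOn hν hV)
    (fun s hs => h.V_nonneg hν hV (toX_mem_Ico hs)) (fun s hs => h.V_le hν hV (toX_mem_Ico hs))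
    (toXi_pos hx).le
  have := (weight_pos hx).le
  gcongr

lemma Theta_nonpos (h : IsNSSolution ν E₀ Vinf Θ V) (hν : 0 < ν) (hE : 0 < E₀) {b : ℝ}
    (hb : b ∈ Ico (0 : ℝ) 1) : Θ b ≤ 0 := by
  have hc : ContinuousOn Θ (Icc 0 b) := h.continuousOn_Theta.mono (Icc_subset_Ico hb.2)
  -- With `|Θ| ≤ L`, where `Θ > 0` one has `νΘ' ≤ Θ²/2 ≤ LΘ/2`, so `Θ exp(-Lt/(2ν))` does not
  -- increase there.
  obtain ⟨L, hL⟩ := isCompact_Icc.exists_bound_of_continuousOn hc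
  have hd : ∀ t ∈ Ioo 0 b, HasDerivAt (fun t => Θ t * Real.exp (-(L / (2 * ν)) * t))
      ((deriv Θ t - L / (2 * ν) * Θ t) * Real.exp (-(L / (2 * ν)) * t)) t := fun t ht => by
    have h1 := (h.differentiableAt_Theta t ⟨ht.1, ht.2.trans hb.2⟩).hasDerivAt.mul
      (((hasDerivAt_id t).const_mul (-(L / (2 * ν)))).exp)
    refine h1.congr_deriv ?_
    simp only [id]
    ring
  have := nonpos_of_deriv_nonpos_of_pos hb.1 (f := fun t => Θ t * Real.exp (-(L / (2 * ν)) * t))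
    (hc.mul (by fun_prop)) (by simp [h.Theta_zero]) (fun t ht hpos => ?_)
    (fun t ht => (hd t ht).differentiableAt)
  · by_contra! hlt
    exact absurd this (not_le.2 (mul_pos hlt (Real.exp_pos _)))
  · rw [(hd t ht).deriv]
    have hΘ : 0 < Θ t := pos_of_mul_pos_left hpos (Real.exp_pos _).le
    have ht1 : t ∈ Ioo (0 : ℝ) 1 := ⟨ht.1, ht.2.trans hb.2⟩
    have hle : Θ t ≤ L := (le_abs_self _).trans (hL t (Ioo_subset_Icc_self ht))
    have heq := h.eq_Theta t ht1
    have hF := F_pos (V := V) hE ht1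
    refine mul_nonpos_of_nonpos_of_nonneg ?_ (Real.exp_pos _).le
    have h5 : deriv Θ t = (Θ t ^ 2 / 2 - F E₀ V t) / ν := by rw [← heq]; field_simp
    rw [h5, show (Θ t ^ 2 / 2 - F E₀ V t) / ν - L / (2 * ν) * Θ t =
      (Θ t * (Θ t - L) / 2 - F E₀ V t) / ν by field_simp; ring]
    refine div_nonpos_of_nonpos_of_nonneg ?_ hν.le
    nlinarith

/-- Take the constant barrier `√(2ℱ(x))` on `[0, x]`: where `-Θ(t)` exceeds it, `Θ(t)²/2 > ℱ(x) ≥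
ℱ(t)`, so `Θ' > 0` and `-Θ` decreases. -/
lemma sq_Theta_le (h : IsNSSolution ν E₀ Vinf Θ V) (hν : 0 < ν) (hE : 0 < E₀) (hV : 0 < Vinf)
    {x : ℝ} (hx : x ∈ Ioo (0 : ℝ) 1) : Θ x ^ 2 / 2 ≤ F E₀ V x := by
  have hF := F_pos (V := V) hE hx
  have key : -Θ x - √(2 * F E₀ V x) ≤ 0 := by
    refine nonpos_of_deriv_nonpos_of_pos hx.1.le (f := fun t => -Θ t - √(2 * F E₀ V x))
      ((h.continuousOn_Theta.mono (Icc_subset_Ico hx.2)).neg.sub continuousOn_const)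
      (by simp [h.Theta_zero]) (fun t ht hpos => ?_)
      (fun t ht => (h.differentiableAt_Theta t ⟨ht.1, ht.2.trans hx.2⟩).neg.sub_const _)
    have ht1 : t ∈ Ioo (0 : ℝ) 1 := ⟨ht.1, ht.2.trans hx.2⟩
    have hdt : HasDerivAt (fun t => -Θ t - √(2 * F E₀ V x)) (-deriv Θ t) t :=
      (h.differentiableAt_Theta t ht1).hasDerivAt.neg.sub_const _
    rw [hdt.deriv]
    have h1 : √(2 * F E₀ V x) < -Θ t := by linarith
    have h2 : 2 * F E₀ V x < (-Θ t) ^ 2 := (Real.sqrt_lt' ((Real.sqrt_nonneg _).trans_lt h1)).1 h1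
    have h3 := h.F_monotoneOn hν hE hV ht1 hx ht.2.le
    have heq := h.eq_Theta t ht1
    by_contra! h4
    have := mul_pos_of_neg_of_neg (neg_neg_of_pos hν) (by linarith : deriv Θ t < 0)
    nlinarith
  have h1 : (-Θ x) ^ 2 ≤ 2 * F E₀ V x :=
    (Real.le_sqrt (by linarith [h.Theta_nonpos hν hE ⟨hx.1.le, hx.2⟩]) (by linarith)).1
      (by linarith)
  linarith [neg_sq (Θ x)]

lemma deriv_Theta_nonpos (h : IsNSSolution ν E₀ Vinf Θ V) (hν : 0 < ν) (hE : 0 < E₀)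
    (hV : 0 < Vinf) {x : ℝ} (hx : x ∈ Ioo (0 : ℝ) 1) : deriv Θ x ≤ 0 := by
  have h1 := h.sq_Theta_le hν hE hV hx
  have h2 := h.eq_Theta x hx
  by_contra! h3
  have := mul_pos hν h3
  linarith

lemma Theta_antitoneOn (h : IsNSSolution ν E₀ Vinf Θ V) (hν : 0 < ν) (hE : 0 < E₀)
    (hV : 0 < Vinf) : AntitoneOn Θ (Ico 0 1) := by
  refine antitoneOn_of_deriv_nonpos (convex_Ico 0 1) h.continuousOn_Theta ?_ ?_
  · rw [interior_Ico]
    exact fun x hx => (h.differentiableAt_Theta x hx).differentiableWithinAt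
  · rw [interior_Ico]
    exact fun x hx => h.deriv_Theta_nonpos hν hE hV hx

lemma neg_Theta_le (h : IsNSSolution ν E₀ Vinf Θ V) (hν : 0 < ν) (hE : 0 < E₀) (hV : 0 < Vinf)
    {x : ℝ} (hx : x ∈ Ico (0 : ℝ) 1) :
    -Θ x ≤ √(2 * (E₀ + Vinf ^ 2 / 2)) / √(1 - x) := by
  rcases hx.1.eq_or_lt with rfl | h0
  · rw [h.Theta_zero]; simp
  have hx' : x ∈ Ioo (0 : ℝ) 1 := ⟨h0, hx.2⟩
  have h1 : 0 < 1 - x := by linarith [hx.2]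
  rw [← Real.sqrt_div (by positivity)]
  refine Real.le_sqrt_of_sq_le ?_
  have h2 := h.sq_Theta_le hν hE hV hx'
  have h3 := h.F_le hν hV hx'
  have h4 := mul_le_mul_of_nonneg_left (weight_le hx')
    (by positivity : 0 ≤ E₀ + Vinf ^ 2 / 2)
  rw [neg_sq, mul_div_assoc, div_eq_mul_one_div]
  linarith

/-- The total variation of `Θ` on `[0, a]`. -/
lemma eVariationOn_Theta_le (h : IsNSSolution ν E₀ Vinf Θ V) (hν : 0 < ν) (hE : 0 < E₀)
    (hV : 0 < Vinf) {a : ℝ} (ha : a ∈ Ioo (0 : ℝ) 1) :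
    eVariationOn Θ (Icc 0 a) ≤
      ENNReal.ofReal (√(2 * (E₀ + Vinf ^ 2 / 2)) / √(1 - a)) := by
  have hanti := (h.Theta_antitoneOn hν hE hV).mono (Icc_subset_Ico ha.2)
  rw [← sub_zero (√(2 * (E₀ + Vinf ^ 2 / 2)) / √(1 - a))]
  refine eVariationOn_le_of_abs_sub_le (g := fun x => -Θ x) (fun x hx y hy hxy => ?_)
    (fun x hx => ?_) fun x hx => ?_
  · rw [abs_of_nonpos (by linarith [hanti hx hy hxy])]
    linarith
  · linarith [h.Theta_nonpos hν hE (Icc_subset_Ico ha.2 hx)]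
  · exact (neg_le_neg (hanti hx ⟨ha.1.le, le_rfl⟩ hx.2)).trans
      (h.neg_Theta_le hν hE hV ⟨ha.1.le, ha.2⟩)

lemma eVariationOn_V_le (h : IsNSSolution ν E₀ Vinf Θ V) (hν : 0 < ν) (hV : 0 < Vinf) :
    eVariationOn V (Ico 0 1) ≤ ENNReal.ofReal Vinf := by
  rw [← sub_zero Vinf]
  refine eVariationOn_le_of_abs_sub_le (g := V) (fun x hx y hy hxy => ?_)
    (fun x hx => h.V_nonneg hν hV hx) fun x hx => h.V_le hν hV hx
  rw [abs_of_nonneg (by linarith [h.V_monotoneOn hν hV hx hy hxy])]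

/-- The sum of `(1 - x²) Θ` and a bounded monotone function independent of `ν` is antitone. -/
lemma add_sqrt_antitoneOn (h : IsNSSolution ν E₀ Vinf Θ V) (hν : 0 < ν) (hE : 0 < E₀)
    (hV : 0 < Vinf) :
    AntitoneOn (fun x => (1 - x ^ 2) * Θ x + 4 * √(2 * (E₀ + Vinf ^ 2 / 2)) * √(1 - x))
      (Icc 0 1) := by
  set c := √(2 * (E₀ + Vinf ^ 2 / 2)) with hc
  have hc0 : 0 ≤ c := Real.sqrt_nonneg _
  have hd : ∀ x ∈ Ioo (0 : ℝ) 1, HasDerivAt (fun x => (1 - x ^ 2) * Θ x + 4 * c * √(1 - x))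
      (-(2 * x) * Θ x + (1 - x ^ 2) * deriv Θ x + 4 * c * (-1 / (2 * √(1 - x)))) x := by
    intro x hx
    have h0 : 1 - x ≠ 0 := by linarith [hx.2]
    refine ((((hasDerivAt_pow 2 x).const_sub 1).mul
      (h.differentiableAt_Theta x hx).hasDerivAt).add
      ((((hasDerivAt_id x).const_sub 1).sqrt h0).const_mul (4 * c))).congr_deriv ?_
    norm_num
  have hanti : AntitoneOn (fun x => (1 - x ^ 2) * Θ x + 4 * c * √(1 - x)) (Ico 0 1) := by
    refine antitoneOn_of_deriv_nonpos (convex_Ico 0 1) ?_ ?_ ?_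
    · exact ((by fun_prop : ContinuousOn (fun x : ℝ => 1 - x ^ 2) _).mul
        h.continuousOn_Theta).add (by fun_prop)
    · rw [interior_Ico]
      exact fun x hx => (hd x hx).differentiableAt.differentiableWithinAt
    · rw [interior_Ico]
      intro x hx
      rw [(hd x hx).deriv]
      have h1 := h.neg_Theta_le hν hE hV ⟨hx.1.le, hx.2⟩
      have h2 := h.deriv_Theta_nonpos hν hE hV hx
      have h3 : 0 < 1 - x ^ 2 := by nlinarith [hx.1, hx.2]
      have h4 : 0 < √(1 - x) := Real.sqrt_pos.2 (by linarith [hx.2])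
      -- The constant `4` is chosen so that this term absorbs `-2xΘ ≤ 2c/√(1 - x)`.
      have h5 : 4 * c * (-1 / (2 * √(1 - x))) = -(2 * (c / √(1 - x))) := by
        field_simp; ring
      rw [h5]
      have h6 : 0 ≤ c / √(1 - x) := by positivity
      nlinarith [mul_le_mul_of_nonneg_left h1 hx.1.le, mul_nonneg h3.le (neg_nonneg.2 h2),
        mul_le_mul_of_nonneg_right hx.2.le h6]
  intro x hx y hy hxy
  -- At `y = 1` the function vanishes whatever `Θ 1` is; it is nonnegative before, since `(1 -
  -- x²)|Θ| ≤ (1 + x)c√(1 - x)`.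
  rcases hy.2.eq_or_lt with rfl | hy1
  · rcases hx.2.eq_or_lt with rfl | hx1
    · exact le_rfl
    · have h1 := h.neg_Theta_le hν hE hV ⟨hx.1, hx1⟩
      have h4 : 0 < √(1 - x) := Real.sqrt_pos.2 (by linarith)
      have h5 := Real.sq_sqrt (by linarith : 0 ≤ 1 - x)
      rw [← hc, le_div_iff₀ h4] at h1
      have h7 : 0 ≤ √(1 - x) * ((1 + x) * (c + Θ x * √(1 - x))) :=
        mul_nonneg h4.le (mul_nonneg (by linarith [hx.1]) (by linarith))
      have h8 : 0 ≤ c * √(1 - x) * (1 - x) := by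
        have : 0 ≤ 1 - x := by linarith
        positivity
      have h9 : 0 ≤ c * √(1 - x) := by positivity
      have h10 : (1 - x ^ 2) * Θ x = (1 + x) * (Θ x * √(1 - x) ^ 2) := by rw [h5]; ring
      simp only [h10]
      norm_num
      nlinarith
  · exact hanti ⟨hx.1, hxy.trans_lt hy1⟩ ⟨hy.1, hy1⟩ hxy

lemma eVariationOn_mul_Theta_le (h : IsNSSolution ν E₀ Vinf Θ V) (hν : 0 < ν) (hE : 0 < E₀)
    (hV : 0 < Vinf) :
    eVariationOn (fun x => (1 - x ^ 2) * Θ x) (Icc 0 1) ≤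
      ENNReal.ofReal (8 * √(2 * (E₀ + Vinf ^ 2 / 2))) := by
  have hanti := h.add_sqrt_antitoneOn hν hE hV
  set c := √(2 * (E₀ + Vinf ^ 2 / 2)) with hc
  have hc0 : 0 ≤ c := Real.sqrt_nonneg _
  -- `(1 - x²)Θ` is a difference of two antitone functions; `g` is minus their sum, so its
  -- increments dominate.
  set g : ℝ → ℝ := fun x => -((1 - x ^ 2) * Θ x + 4 * c * √(1 - x)) - 4 * c * √(1 - x) with hg
  have hgm : MonotoneOn g (Icc 0 1) := fun x hx y hy hxy => by
    have h1 := hanti hx hy hxy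
    have h2 : √(1 - y) ≤ √(1 - x) := Real.sqrt_le_sqrt (by linarith)
    have h3 := mul_le_mul_of_nonneg_left h2 hc0
    simp only [hg] at h1 ⊢
    linarith
  have h01 : (0 : ℝ) ∈ Icc (0 : ℝ) 1 := ⟨le_rfl, zero_le_one⟩
  have h11 : (1 : ℝ) ∈ Icc (0 : ℝ) 1 := ⟨zero_le_one, le_rfl⟩
  have hg0 : g 0 = -(8 * c) := by simp [hg, h.Theta_zero]; ring
  have hg1 : g 1 = 0 := by simp [hg]
  have := eVariationOn_le_of_abs_sub_le (s := Icc 0 1) (f := fun x => (1 - x ^ 2) * Θ x)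
    (g := g) (A := -(8 * c)) (B := 0) (fun x hx y hy hxy => ?_)
    (fun x hx => hg0 ▸ hgm h01 hx hx.1) (fun x hx => hg1 ▸ hgm hx h11 hx.2)
  · simpa using this
  · have h1 := hanti hx hy hxy
    have h2 : √(1 - y) ≤ √(1 - x) := Real.sqrt_le_sqrt (by linarith)
    have h3 := mul_le_mul_of_nonneg_left h2 hc0
    simp only [hg] at h1 ⊢
    rw [abs_le]
    constructor <;> linarith

/-- At points `y < x`, either `Θ²/2` at `x` nearly dominates `ℱ` at `y`, or `Θ(x)` is very
negative. -/
lemma sub_le_sq_Theta (h : IsNSSolution ν E₀ Vinf Θ V) (hν : 0 < ν) (hE : 0 < E₀)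
    (hV : 0 < Vinf) {x y η : ℝ} (hy : y ∈ Ioo (0 : ℝ) 1) (hx : x ∈ Ioo (0 : ℝ) 1) (hyx : y ≤ x) :
    F E₀ V y - η ≤ Θ x ^ 2 / 2 ∨ Θ x ≤ -(η * (x - y) / ν) := by
  by_cases hcase : F E₀ V y - η ≤ Θ x ^ 2 / 2
  · exact Or.inl hcase
  refine Or.inr ?_
  rw [not_le] at hcase
  have hsub : Icc y x ⊆ Ico (0 : ℝ) 1 := fun t ht => ⟨hy.1.le.trans ht.1, ht.2.trans_lt hx.2⟩
  have hsub' : Ioo y x ⊆ Ioo (0 : ℝ) 1 := fun t ht => ⟨hy.1.trans ht.1, ht.2.trans hx.2⟩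
  have hd : ∀ t ∈ Ioo y x, HasDerivAt (fun t => Θ t + η / ν * t) (deriv Θ t + η / ν) t :=
    fun t ht => ((h.differentiableAt_Theta t (hsub' ht)).hasDerivAt.add
      ((hasDerivAt_id t).const_mul (η / ν))).congr_deriv (by rw [mul_one])
  -- On `(y, x)`, `Θ(t)² ≤ Θ(x)²` and `ℱ(t) ≥ ℱ(y)`, so `νΘ' ≤ -η`.
  have hanti : AntitoneOn (fun t => Θ t + η / ν * t) (Icc y x) := by
    refine antitoneOn_of_deriv_nonpos (convex_Icc y x) ?_ ?_ ?_
    · exact (h.continuousOn_Theta.mono hsub).add (by fun_prop)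
    · rw [interior_Icc]
      exact fun t ht => (hd t ht).differentiableAt.differentiableWithinAt
    · rw [interior_Icc]
      intro t ht
      rw [(hd t ht).deriv]
      have ht1 := hsub' ht
      have h1 := h.F_monotoneOn hν hE hV hy ht1 ht.1.le
      have h2 := h.Theta_antitoneOn hν hE hV (hsub (Ioo_subset_Icc_self ht)) ⟨hx.1.le, hx.2⟩
        ht.2.le
      have h3 := h.Theta_nonpos hν hE (hsub (Ioo_subset_Icc_self ht))
      have h4 := h.eq_Theta t ht1
      have h5 : deriv Θ t + η / ν = (ν * deriv Θ t + η) / ν := by field_simp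
      rw [h5, h4]
      refine div_nonpos_of_nonpos_of_nonneg ?_ hν.le
      nlinarith
  have h1 := hanti ⟨le_rfl, hyx⟩ ⟨hyx, le_rfl⟩ hyx
  have h2 := h.Theta_nonpos hν hE ⟨hy.1.le, hy.2⟩
  simp only at h1
  have h3 : η * (x - y) / ν = η / ν * x - η / ν * y := by ring
  linarith

/-- If `Θ ≤ -δ` at `x` then `V` is within `ν V∞ / (δ x)` of its limit there. -/
lemma le_V (h : IsNSSolution ν E₀ Vinf Θ V) (hν : 0 < ν) (hE : 0 < E₀) (hV : 0 < Vinf)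
    {x δ : ℝ} (hx : x ∈ Ioo (0 : ℝ) 1) (hδ : 0 < δ) (hΘ : Θ x ≤ -δ) :
    Vinf - ν * Vinf / (δ * x) ≤ V x := by
  have hconc : AntitoneOn (deriv V) (Ioo 0 1) := by
    refine antitoneOn_of_deriv_nonpos (convex_Ioo 0 1)
      (fun t ht => (h.differentiableAt_deriv_V t ht).continuousAt.continuousWithinAt) ?_ ?_
    · rw [interior_Ioo]
      exact fun t ht => (h.differentiableAt_deriv_V t ht).differentiableWithinAt
    · rw [interior_Ioo]
      intro t ht
      have h1 := h.eq_V t ht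
      have h2 := h.Theta_nonpos hν hE ⟨ht.1.le, ht.2⟩
      have h3 := h.deriv_V_nonneg hν hV t ht
      by_contra! h4
      have := mul_pos hν h4
      nlinarith
  -- Concavity and `V 0 = 0` give `x V'(x) ≤ V(x)`.
  have hVx : deriv V x * x ≤ Vinf := by
    obtain ⟨t, ht, hteq⟩ := exists_deriv_eq_slope V hx.1
      (h.continuousOn_V.mono (Icc_subset_Ico hx.2))
      (fun t ht => (h.differentiableAt_V t ⟨ht.1, ht.2.trans hx.2⟩).differentiableWithinAt)
    rw [h.V_zero, sub_zero, sub_zero, eq_div_iff hx.1.ne'] at hteq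
    have h1 := hconc ⟨ht.1, ht.2.trans hx.2⟩ hx ht.2.le
    have h2 := h.V_le hν hV ⟨hx.1.le, hx.2⟩
    nlinarith [mul_le_mul_of_nonneg_right h1 hx.1.le]
  -- Past `x` one has `Θ ≤ -δ`, hence `νV'' + δV' ≤ 0`.
  have hanti : AntitoneOn (fun t => ν * deriv V t + δ * V t) (Ico x 1) := by
    have hd : ∀ t ∈ Ioo (0 : ℝ) 1, HasDerivAt (fun t => ν * deriv V t + δ * V t)
        (ν * deriv (deriv V) t + δ * deriv V t) t := fun t ht =>
      ((h.differentiableAt_deriv_V t ht).hasDerivAt.const_mul ν).add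
        ((h.differentiableAt_V t ht).hasDerivAt.const_mul δ)
    have hsub : Ico x 1 ⊆ Ioo (0 : ℝ) 1 := fun t ht => ⟨hx.1.trans_le ht.1, ht.2⟩
    refine antitoneOn_of_deriv_nonpos (convex_Ico x 1)
      (fun t ht => (hd t (hsub ht)).continuousAt.continuousWithinAt) ?_ ?_
    · exact fun t ht =>
        (hd t (hsub (interior_subset ht))).differentiableAt.differentiableWithinAt
    · intro t ht
      have ht' := hsub (interior_subset ht)
      have hxt := (interior_subset ht : t ∈ Ico x 1).1
      rw [(hd t ht').deriv, h.eq_V t ht']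
      have h1 := h.Theta_antitoneOn hν hE hV ⟨hx.1.le, hx.2⟩ ⟨ht'.1.le, ht'.2⟩ hxt
      have h2 := h.deriv_V_nonneg hν hV t ht'
      nlinarith
  have hlim : δ * Vinf ≤ ν * deriv V x + δ * V x := by
    refine le_of_tendsto (h.V_one.const_mul δ) ?_
    filter_upwards [Ioo_mem_nhdsLT hx.2] with t ht
    have h1 := hanti ⟨le_rfl, hx.2⟩ ⟨ht.1.le, ht.2⟩ ht.1.le
    have h2 := mul_nonneg hν.le (h.deriv_V_nonneg hν hV t ⟨hx.1.trans ht.1, ht.2⟩)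
    simp only at h1
    linarith
  have h1 : ν * deriv V x ≤ ν * Vinf / x := by
    rw [le_div_iff₀ hx.1]
    nlinarith
  have h2 : ν * Vinf / (δ * x) = ν * Vinf / x / δ := by field_simp
  rw [h2, sub_le_iff_le_add, ← sub_le_iff_le_add', le_div_iff₀ hδ]
  linarith

end IsNSSolution

end SwirlingFlow

namespace SwirlingFlow

/-! ### The inviscid limit. -/

section Limit

variable {E₀ Vinf : ℝ} {N : ℕ → ℝ} {Θ V : ℕ → ℝ → ℝ}

lemma eventually_le_div {N : ℕ → ℝ} (hN : ∀ n, 0 < N n) (hN0 : Tendsto N atTop (𝓝 0)) {a : ℝ}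
    (ha : 0 < a) (b : ℝ) : ∀ᶠ n in atTop, b ≤ a / N n := by
  have h : Tendsto (fun n => a / N n) atTop atTop := by
    have : Tendsto N atTop (𝓝[>] 0) :=
      tendsto_nhdsWithin_iff.2 ⟨hN0, Eventually.of_forall hN⟩
    simpa only [div_eq_mul_inv, Function.comp_def] using
      (tendsto_inv_nhdsGT_zero.comp this).const_mul_atTop ha
  exact h.eventually_ge_atTop b

lemma exists_eventually_Theta_le (h : ∀ n, IsNSSolution (N n) E₀ Vinf (Θ n) (V n))
    (hN : ∀ n, 0 < N n) (hN0 : Tendsto N atTop (𝓝 0)) (hE : 0 < E₀) (hV : 0 < Vinf) {x : ℝ}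
    (hx : x ∈ Ioo (0 : ℝ) 1) : ∃ δ > 0, ∀ᶠ n in atTop, Θ n x ≤ -δ := by
  have hy : x / 2 ∈ Ioo (0 : ℝ) 1 := ⟨by linarith [hx.1], by linarith [hx.1, hx.2]⟩
  have hw := weight_pos hy
  -- Half the lower bound for `ℱ(x/2)`, so the first alternative gives `Θ²/2 ≥ η`; for small `ν` the
  -- second gives `Θ ≤ -√(2η)` as well.
  set η := E₀ * weight (x / 2) / 2 with hη
  have hη0 : 0 < η := by positivity
  refine ⟨√(2 * η), Real.sqrt_pos.2 (by positivity), ?_⟩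
  filter_upwards [eventually_le_div hN hN0 (mul_pos hη0 (sub_pos.2 (half_lt_self hx.1)))
    (√(2 * η))] with n hn
  rcases (h n).sub_le_sq_Theta (hN n) hE hV (η := η) hy hx (half_le_self hx.1.le) with h1 | h1
  · have h2 := IsNSSolution.F_ge (E₀ := E₀) (V := V n) hy
    have h3 := (h n).Theta_nonpos (hN n) hE ⟨hx.1.le, hx.2⟩
    refine le_neg_of_le_neg (Real.sqrt_le_iff.2 ⟨by linarith, ?_⟩)
    rw [neg_sq]
    linarith
  · linarith

lemma tendsto_V (h : ∀ n, IsNSSolution (N n) E₀ Vinf (Θ n) (V n))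
    (hN : ∀ n, 0 < N n) (hN0 : Tendsto N atTop (𝓝 0)) (hE : 0 < E₀) (hV : 0 < Vinf) {x : ℝ}
    (hx : x ∈ Ioo (0 : ℝ) 1) : Tendsto (fun n => V n x) atTop (𝓝 Vinf) := by
  obtain ⟨δ, hδ, hev⟩ := exists_eventually_Theta_le h hN hN0 hE hV hx
  have hl : Tendsto (fun n => Vinf - N n * Vinf / (δ * x)) atTop (𝓝 Vinf) := by
    simpa using ((hN0.mul_const Vinf).div_const (δ * x)).const_sub Vinf
  refine tendsto_of_tendsto_of_tendsto_of_le_of_le' hl tendsto_const_nhds ?_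
    (Eventually.of_forall fun n => (h n).V_le (hN n) hV ⟨hx.1.le, hx.2⟩)
  filter_upwards [hev] with n hn
  exact (h n).le_V (hN n) hE hV hx hδ hn

lemma tendsto_tailMean (h : ∀ n, IsNSSolution (N n) E₀ Vinf (Θ n) (V n))
    (hN : ∀ n, 0 < N n) (hN0 : Tendsto N atTop (𝓝 0)) (hE : 0 < E₀) (hV : 0 < Vinf) {ξ : ℝ}
    (hξ : 0 < ξ) :
    Tendsto (fun n => tailMean (fun s => V n (toX s)) ξ) atTop (𝓝 (Vinf ^ 2 / 2)) := by
  have hmono := fun n => (h n).comp_monotoneOn (hN n) hV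
  have hnn := fun n s (hs : (0 : ℝ) ≤ s) =>
    (h n).V_nonneg (hN n) hV (IsNSSolution.toX_mem_Ico hs)
  have hle := fun n s (hs : (0 : ℝ) ≤ s) => (h n).V_le (hN n) hV (IsNSSolution.toX_mem_Ico hs)
  refine tendsto_order.2 ⟨fun a ha => ?_, fun a ha => Eventually.of_forall fun n =>
    (tailMean_le (hmono n) (hnn n) (hle n) hξ.le).trans_lt ha⟩
  have hε : ∀ᶠ ε in 𝓝[>] (0 : ℝ), a < Vinf ^ 2 * (1 - ε ^ 2 / ξ ^ 2) / 2 := by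
    have hc : Continuous fun ε : ℝ => Vinf ^ 2 * (1 - ε ^ 2 / ξ ^ 2) / 2 := by fun_prop
    have := hc.tendsto 0
    simp only [ne_eq, OfNat.ofNat_ne_zero, not_false_eq_true, zero_pow, zero_div, sub_zero,
      mul_one] at this
    exact nhdsWithin_le_nhds (this.eventually_const_lt ha)
  obtain ⟨ε, hεa, hε0, hεξ⟩ := (hε.and (Ioo_mem_nhdsGT hξ)).exists
  have hlim : Tendsto (fun n => V n (toX ε) ^ 2 * (1 - ε ^ 2 / ξ ^ 2) / 2) atTop
      (𝓝 (Vinf ^ 2 * (1 - ε ^ 2 / ξ ^ 2) / 2)) :=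
    (((tendsto_V h hN hN0 hE hV (toX_mem hε0)).pow 2).mul_const _).div_const 2
  filter_upwards [hlim.eventually_const_lt hεa] with n hn
  exact hn.trans_le ((le_radialMean (hmono n) (hnn n) hε0 hεξ.le).trans
    (radialMean_le_tailMean (hmono n) (hnn n) (hle n) hξ))

lemma tendsto_F (h : ∀ n, IsNSSolution (N n) E₀ Vinf (Θ n) (V n))
    (hN : ∀ n, 0 < N n) (hN0 : Tendsto N atTop (𝓝 0)) (hE : 0 < E₀) (hV : 0 < Vinf) {x : ℝ}
    (hx : x ∈ Ioo (0 : ℝ) 1) :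
    Tendsto (fun n => F E₀ (V n) x) atTop (𝓝 (weight x * (E₀ + Vinf ^ 2 / 2))) := by
  simp_rw [F_eq E₀ _ hx]
  exact ((tendsto_tailMean h hN hN0 hE hV (toXi_pos hx)).const_add E₀).const_mul _

/-- The limit of `Θ` in the variable `x`. -/
noncomputable def eulerTheta (E₀ Vinf x : ℝ) : ℝ := -√(2 * (weight x * (E₀ + Vinf ^ 2 / 2)))

lemma tendsto_Theta (h : ∀ n, IsNSSolution (N n) E₀ Vinf (Θ n) (V n))
    (hN : ∀ n, 0 < N n) (hN0 : Tendsto N atTop (𝓝 0)) (hE : 0 < E₀) (hV : 0 < Vinf) {x : ℝ}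
    (hx : x ∈ Ioo (0 : ℝ) 1) :
    Tendsto (fun n => Θ n x) atTop (𝓝 (eulerTheta E₀ Vinf x)) := by
  have hsq : Tendsto (fun n => Θ n x ^ 2 / 2) atTop
      (𝓝 (weight x * (E₀ + Vinf ^ 2 / 2))) := by
    refine tendsto_order.2 ⟨fun a ha => ?_, fun a ha => Eventually.of_forall fun n => ?_⟩
    · have hc : ContinuousAt (fun y => weight y * (E₀ + Vinf ^ 2 / 2)) x :=
        (continuousOn_weight.continuousAt (isOpen_Ioo.mem_nhds hx)).mul_const _
      have hev : ∀ᶠ y in 𝓝[<] x, a < weight y * (E₀ + Vinf ^ 2 / 2) :=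
        nhdsWithin_le_nhds (hc.eventually_const_lt ha)
      -- Continuity of the weight supplies `y < x` whose limit value still exceeds `a`; the gap `b -
      -- a` serves as `η`.
      obtain ⟨y, hya, hy0, hyx⟩ := (hev.and (Ioo_mem_nhdsLT hx.1)).exists
      have hy : y ∈ Ioo (0 : ℝ) 1 := ⟨hy0, hyx.trans hx.2⟩
      obtain ⟨b, hab, hby⟩ := exists_between hya
      have hF := (tendsto_F h hN hN0 hE hV hy).eventually_const_lt hby
      filter_upwards [hF, eventually_le_div hN hN0
        (mul_pos (sub_pos.2 hab) (sub_pos.2 hyx)) (|a| + 2)] with n hn1 hn2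
      rcases (h n).sub_le_sq_Theta (hN n) hE hV (η := b - a) hy hx hyx.le with h1 | h1
      · linarith
      · have h2 : |a| + 2 ≤ -Θ n x := by linarith
        nlinarith [abs_nonneg a, le_abs_self a]
    · have h1 := (h n).sq_Theta_le (hN n) hE hV hx
      have h2 := (h n).F_le (hN n) hV hx
      linarith
  have hroot := ((hsq.const_mul 2).sqrt).neg
  refine hroot.congr fun n => ?_
  rw [mul_div_cancel₀ _ (two_ne_zero), Real.sqrt_sq_eq_abs,
    abs_of_nonpos ((h n).Theta_nonpos (hN n) hE ⟨hx.1.le, hx.2⟩), neg_neg]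

end Limit

/-! ### The limit profile -/

section Profile

variable {E₀ Vinf : ℝ}

lemma toXi_toX {ξ : ℝ} (hξ : 0 < ξ) : toXi (toX ξ) = ξ :=
  strictMono_toX.injective (toX_toXi (toX_mem hξ))

lemma eulerTheta_toX (E₀ Vinf : ℝ) {ξ : ℝ} (hξ : 0 ≤ ξ) :
    eulerTheta E₀ Vinf (toX ξ) / √(1 + ξ ^ 2) = -√(2 * (E₀ + Vinf ^ 2 / 2) * phi ξ) := by
  have hs := sqrt_one_add_sq_pos ξ
  unfold eulerTheta
  rw [neg_div, ← Real.sqrt_div' _ (by positivity)]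
  congr 2
  rcases hξ.eq_or_lt with rfl | hpos
  · simp [toX, weight, phi]
  · have := one_add_sq_mul_phi (toX_mem hpos)
    rw [toXi_toX hpos] at this
    rw [← this]
    field_simp

lemma hasDerivAt_phi (ξ : ℝ) : HasDerivAt phi ((1 - 2 * phi ξ) / √(1 + ξ ^ 2)) ξ := by
  have h : HasDerivAt phi _ ξ :=
    (hasDerivAt_id ξ).mul ((hasDerivAt_sqrt_one_add_sq ξ).sub (hasDerivAt_id ξ))
  refine h.congr_deriv ?_
  have hs := sqrt_one_add_sq_pos ξ
  have hq := sq_sqrt_one_add_sq ξ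
  simp only [id, phi]
  field_simp
  linear_combination hq

lemma contDiff_phi : ContDiff ℝ ∞ phi := by
  unfold phi
  exact contDiff_id.mul ((ContDiff.sqrt (by fun_prop) fun x => by positivity).sub contDiff_id)

lemma contDiff_toX : ContDiff ℝ ∞ toX := by
  unfold toX
  exact contDiff_id.div (ContDiff.sqrt (by fun_prop) fun x => by positivity)
    fun x => (sqrt_one_add_sq_pos x).ne'

/-- The left side is `2φ - ξφ'`; this identity drives both the third Euler equation and the formula
for `W`. -/
lemma two_mul_phi_sub (ξ : ℝ) : 2 * phi ξ - ξ * ((1 - 2 * phi ξ) / √(1 + ξ ^ 2)) = toX ξ := by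
  have hs := sqrt_one_add_sq_pos ξ
  have hq := sq_sqrt_one_add_sq ξ
  unfold phi toX
  field_simp
  linear_combination (2 * ξ) * hq

lemma phi_le_half (ξ : ℝ) : phi ξ ≤ 1 / 2 := by
  have hq := sq_sqrt_one_add_sq ξ
  unfold phi
  nlinarith [sq_nonneg (√(1 + ξ ^ 2) - 2 * ξ), sq_nonneg (√(1 + ξ ^ 2) - ξ)]

/-- Keeps `k₀/(2φ)` at most `2k₀` for `ξ ≥ 1`, as the decay of `U` requires. -/
lemma one_fourth_le_phi {ξ : ℝ} (hξ : 1 ≤ ξ) : 1 / 4 ≤ phi ξ := by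
  have hs := sqrt_one_add_sq_pos ξ
  have h1 : ξ + 1 / (4 * ξ) ≤ √(1 + ξ ^ 2) := by
    refine Real.le_sqrt_of_sq_le ?_
    have h2 : 1 / (4 * ξ) ≤ 1 / 4 := by
      rw [div_le_div_iff₀ (by positivity) (by norm_num)]; linarith
    have h3 : 0 ≤ 1 / (4 * ξ) := by positivity
    have h4 : ξ * (1 / (4 * ξ)) = 1 / 4 := by field_simp
    nlinarith
  have h2 : ξ * (1 / (4 * ξ)) ≤ ξ * (√(1 + ξ ^ 2) - ξ) := by
    gcongr
    linarith
  have h4 : ξ * (1 / (4 * ξ)) = 1 / 4 := by field_simp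
  unfold phi
  linarith

variable (E₀ Vinf) in
/-- The stream function of the limit profile. -/
noncomputable def eulerStream (ξ : ℝ) : ℝ := eulerTheta E₀ Vinf (toX ξ) / √(1 + ξ ^ 2)

lemma eulerStream_eq {ξ : ℝ} (hξ : 0 ≤ ξ) :
    eulerStream E₀ Vinf ξ = -√(2 * (E₀ + Vinf ^ 2 / 2) * phi ξ) := eulerTheta_toX E₀ Vinf hξ

lemma sq_eulerStream (hk : 0 < E₀ + Vinf ^ 2 / 2) {ξ : ℝ} (hξ : 0 < ξ) :
    eulerStream E₀ Vinf ξ ^ 2 / 2 = (E₀ + Vinf ^ 2 / 2) * phi ξ := by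
  have := phi_pos hξ
  rw [eulerStream_eq hξ.le, neg_sq, Real.sq_sqrt (by positivity)]
  ring

lemma sqrt_div_two_mul_phi {k ξ : ℝ} (hk : 0 < k) (hξ : 0 < ξ) :
    √(k / (2 * phi ξ)) = k / √(2 * k * phi ξ) := by
  have := phi_pos hξ
  rw [show k / (2 * phi ξ) = k ^ 2 / (2 * k * phi ξ) by field_simp,
    Real.sqrt_div (by positivity), Real.sqrt_sq hk.le]

lemma deriv_eulerStream (hk : 0 < E₀ + Vinf ^ 2 / 2) {ξ : ℝ} (hξ : 0 < ξ) :
    deriv (eulerStream E₀ Vinf) ξ = -(√((E₀ + Vinf ^ 2 / 2) / (2 * phi ξ)) *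
      ((1 - 2 * phi ξ) / √(1 + ξ ^ 2))) := by
  have hφ := phi_pos hξ
  set k := E₀ + Vinf ^ 2 / 2 with hk'
  have heq : eulerStream E₀ Vinf =ᶠ[𝓝 ξ] fun η => -√(2 * k * phi η) := by
    filter_upwards [Ioi_mem_nhds hξ] with η hη
    exact eulerStream_eq (le_of_lt hη)
  have hd : HasDerivAt (fun η => -√(2 * k * phi η)) _ ξ :=
    ((hasDerivAt_phi ξ).const_mul (2 * k)).sqrt (by positivity) |>.neg
  rw [heq.deriv_eq, hd.deriv, sqrt_div_two_mul_phi hk hξ]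
  have hr : 0 < √(2 * k * phi ξ) := Real.sqrt_pos.2 (by positivity)
  have hs := sqrt_one_add_sq_pos ξ
  field_simp

lemma contDiffOn_eulerStream (hk : 0 < E₀ + Vinf ^ 2 / 2) :
    ContDiffOn ℝ ∞ (eulerStream E₀ Vinf) (Ioi 0) := by
  have h : ContDiffOn ℝ ∞ (fun ξ => -√(2 * (E₀ + Vinf ^ 2 / 2) * phi ξ)) (Ioi 0) := by
    refine (ContDiffOn.sqrt (contDiff_const.mul contDiff_phi).contDiffOn fun ξ hξ => ?_).neg
    have := phi_pos hξ
    positivity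
  exact h.congr fun ξ hξ => eulerStream_eq (le_of_lt hξ)

variable (E₀ Vinf) in
/-- The pressure of the limit profile. -/
noncomputable def eulerPressure (ξ : ℝ) : ℝ := E₀ - (E₀ + Vinf ^ 2 / 2) * toX ξ

lemma isSmoothSelfSimilarSolution_euler (hk : 0 < E₀ + Vinf ^ 2 / 2) :
    IsSmoothSelfSimilarSolution 0 (eulerStream E₀ Vinf) (fun _ => Vinf)
      (eulerPressure E₀ Vinf) where
  smooth_theta := contDiffOn_eulerStream hk
  smooth_V := contDiffOn_const
  smooth_P := (contDiff_const.sub (contDiff_const.mul contDiff_toX)).contDiffOn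
  eq_one ξ hξ := by
    have heq : (fun η => eulerStream E₀ Vinf η ^ 2 / 2 + (1 + η ^ 2) * eulerPressure E₀ Vinf η)
        =ᶠ[𝓝 ξ] fun η => E₀ + -(Vinf ^ 2 / 2) * η ^ 2 := by
      filter_upwards [Ioi_mem_nhds hξ] with η hη
      rw [sq_eulerStream hk hη]
      have hs := sqrt_one_add_sq_pos η
      have hq := sq_sqrt_one_add_sq η
      have h1 : (1 + η ^ 2) * toX η = η * √(1 + η ^ 2) := by
        rw [toX, mul_div_assoc', div_eq_iff hs.ne']
        linear_combination (-η) * hq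
      unfold eulerPressure phi
      linear_combination (-(E₀ + Vinf ^ 2 / 2)) * h1
    rw [heq.deriv_eq, (((hasDerivAt_pow 2 ξ).const_mul (-(Vinf ^ 2 / 2))).const_add E₀).deriv]
    norm_num
    ring
  eq_two ξ hξ := by simp
  eq_three ξ hξ := by
    -- The bracket is `k₀(2φ - ξφ') + E₀ - k₀ toX ξ`, identically `E₀`.
    have heq : (fun η => eulerStream E₀ Vinf η ^ 2 -
        η * deriv (fun τ => eulerStream E₀ Vinf τ ^ 2 / 2) η + eulerPressure E₀ Vinf η)
        =ᶠ[𝓝 ξ] fun _ => E₀ := by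
      filter_upwards [Ioi_mem_nhds hξ] with η hη
      have heq' : (fun τ => eulerStream E₀ Vinf τ ^ 2 / 2) =ᶠ[𝓝 η]
          fun τ => (E₀ + Vinf ^ 2 / 2) * phi τ := by
        filter_upwards [Ioi_mem_nhds hη] with τ hτ
        exact sq_eulerStream hk hτ
      rw [heq'.deriv_eq, ((hasDerivAt_phi η).const_mul _).deriv]
      have h1 := sq_eulerStream hk hη
      have h2 := two_mul_phi_sub η
      unfold eulerPressure
      linear_combination 2 * h1 + (E₀ + Vinf ^ 2 / 2) * h2
    rw [heq.deriv_eq, deriv_const, zero_mul]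

lemma isNegativeEulerProfile_euler (hk : 0 < E₀ + Vinf ^ 2 / 2) :
    IsNegativeEulerProfile E₀ Vinf (eulerStream E₀ Vinf) (fun _ => Vinf)
      (eulerPressure E₀ Vinf) where
  theta_eq ξ hξ := eulerStream_eq hξ
  V_eq _ _ := rfl
  U_eq ξ hξ := by rw [deriv_eulerStream hk hξ, neg_neg]
  W_eq ξ hξ := by
    have hφ := phi_pos hξ
    rw [deriv_eulerStream hk hξ, eulerStream_eq (le_of_lt hξ), sqrt_div_two_mul_phi hk hξ]
    have h2 := two_mul_phi_sub ξ
    unfold toX at h2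
    rw [← h2]
    have hr : 0 < √(2 * (E₀ + Vinf ^ 2 / 2) * phi ξ) := Real.sqrt_pos.2 (by positivity)
    have hrq := Real.sq_sqrt (by positivity : 0 ≤ 2 * (E₀ + Vinf ^ 2 / 2) * phi ξ)
    have h3 : √(2 * (E₀ + Vinf ^ 2 / 2) * phi ξ) = (E₀ + Vinf ^ 2 / 2) /
        √(2 * (E₀ + Vinf ^ 2 / 2) * phi ξ) * (2 * phi ξ) := by
      rw [div_mul_eq_mul_div, eq_div_iff hr.ne', ← pow_two, hrq]
      ring
    linear_combination (-1) * h3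
  P_eq _ _ := rfl
  theta_zero := by rw [eulerStream_eq le_rfl]; simp [phi]
  U_infty := by
    have hlim : Tendsto (fun ξ : ℝ => √(2 * (E₀ + Vinf ^ 2 / 2)) * ξ⁻¹) atTop (𝓝 0) := by
      simpa only [mul_zero] using
        tendsto_inv_atTop_zero.const_mul (√(2 * (E₀ + Vinf ^ 2 / 2)))
    refine squeeze_zero' ?_ ?_ hlim
    · filter_upwards [eventually_gt_atTop 0] with ξ hξ
      rw [deriv_eulerStream hk hξ, neg_neg]
      have := phi_le_half ξ
      exact mul_nonneg (Real.sqrt_nonneg _) (div_nonneg (by linarith) (Real.sqrt_nonneg _))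
    · filter_upwards [eventually_ge_atTop 1] with ξ hξ
      have hξ0 : 0 < ξ := by linarith
      have hφ := phi_pos hξ0
      have hφ4 := one_fourth_le_phi hξ
      rw [deriv_eulerStream hk hξ0, neg_neg]
      have h1 : ξ ≤ √(1 + ξ ^ 2) := Real.le_sqrt_of_sq_le (by linarith)
      have hs := sqrt_one_add_sq_pos ξ
      gcongr ?_ * ?_
      · have := phi_le_half ξ
        exact div_nonneg (by linarith) hs.le
      · refine Real.sqrt_le_sqrt ?_
        rw [div_le_iff₀ (by positivity)]
        nlinarith
      · rw [← one_div]
        gcongr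
        linarith

end Profile

end SwirlingFlow

/-! ### Assembly. -/

theorem mainTheorem1 (E₀ Vinf : ℝ) (hE₀ : 0 < E₀) (hVinf : 0 < Vinf)
    (I : Set ℝ) (hI : ∀ ν ∈ I, 0 < ν) (Θ V : ℝ → ℝ → ℝ)
    (hsol : ∀ ν ∈ I, SwirlingFlow.IsNSSolution ν E₀ Vinf (Θ ν) (V ν)) :
    -- the family has uniformly bounded variation
    (∃ C : ℝ≥0, ∀ ν ∈ I,
      eVariationOn (fun x => (1 - x ^ 2) * Θ ν x) (Icc 0 1) ≤ C ∧
      eVariationOn (V ν) (Ico 0 1) ≤ C) ∧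
    (∀ a ∈ Ioo (0 : ℝ) 1, ∃ C : ℝ≥0, ∀ ν ∈ I, eVariationOn (Θ ν) (Icc 0 a) ≤ C) ∧
    -- convergence along subsequences to the Euler solution with the negative sign
    (∀ ν : ℕ → ℝ, (∀ n, ν n ∈ I) → Tendsto ν atTop (𝓝 0) →
      ∃ k : ℕ → ℕ, StrictMono k ∧ ∃ Θlim Vlim : ℝ → ℝ,
        (∀ᵐ x ∂(volume.restrict (Ioo (0 : ℝ) 1)),
          Tendsto (fun n => Θ (ν (k n)) x) atTop (𝓝 (Θlim x))) ∧
        (∀ᵐ x ∂(volume.restrict (Ioo (0 : ℝ) 1)),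
          Tendsto (fun n => V (ν (k n)) x) atTop (𝓝 (Vlim x))) ∧
        (∀ x ∈ Ioo (0 : ℝ) 1, Θlim x < 0) ∧
        ∃ P : ℝ → ℝ,
          SwirlingFlow.IsSmoothSelfSimilarSolution 0
            (fun ξ => Θlim (SwirlingFlow.toX ξ) / √(1 + ξ ^ 2))
            (fun ξ => Vlim (SwirlingFlow.toX ξ)) P ∧
          SwirlingFlow.IsNegativeEulerProfile E₀ Vinf
            (fun ξ => Θlim (SwirlingFlow.toX ξ) / √(1 + ξ ^ 2))
            (fun ξ => Vlim (SwirlingFlow.toX ξ)) P) := by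
  have hk : 0 < E₀ + Vinf ^ 2 / 2 := by positivity
  refine ⟨?_, fun a ha => ?_, fun ν hνI hν0 => ?_⟩
  · refine ⟨(8 * √(2 * (E₀ + Vinf ^ 2 / 2)) + Vinf).toNNReal, fun ν hν => ⟨?_, ?_⟩⟩
    · exact ((hsol ν hν).eVariationOn_mul_Theta_le (hI ν hν) hE₀ hVinf).trans
        (ENNReal.ofReal_le_ofReal (by linarith))
    · exact ((hsol ν hν).eVariationOn_V_le (hI ν hν) hVinf).trans
        (ENNReal.ofReal_le_ofReal (le_add_of_nonneg_left (by positivity)))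
  · exact ⟨_, fun ν hν => (hsol ν hν).eVariationOn_Theta_le (hI ν hν) hE₀ hVinf ha⟩
  · have hs := fun n => hsol (ν n) (hνI n)
    have hp := fun n => hI (ν n) (hνI n)
    -- The whole sequence converges, so the subsequence is the sequence itself.
    refine ⟨id, strictMono_id, SwirlingFlow.eulerTheta E₀ Vinf, fun _ => Vinf, ?_, ?_, ?_,
      SwirlingFlow.eulerPressure E₀ Vinf, SwirlingFlow.isSmoothSelfSimilarSolution_euler hk,
      SwirlingFlow.isNegativeEulerProfile_euler hk⟩
    · filter_upwards [ae_restrict_mem measurableSet_Ioo] with x hx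
      exact SwirlingFlow.tendsto_Theta hs hp hν0 hE₀ hVinf hx
    · filter_upwards [ae_restrict_mem measurableSet_Ioo] with x hx
      exact SwirlingFlow.tendsto_V hs hp hν0 hE₀ hVinf hx
    · intro x hx
      have := SwirlingFlow.weight_pos hx
      exact neg_neg_of_pos (Real.sqrt_pos.2 (by positivity))
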